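/- Let $0<\mu_1\le L_1$ and $0<\mu_2\le L_1$. For $f:\mathbb R^m\times\mathbb R^n\to\mathbb R$ consider the following conditions. (a) Two-sided PL: $f$ is continuously differentiable and, for all $x,y$, $\|\nabla_xf(x,y)\|^2\ge 2\mu_1\,(f(x,y)-\min_{x'}f(x',y))$ and $\|\nabla_yf(x,y)\|^2\ge2\mu_2\,(\max_{y'}f(x,y')-f(x,y))$. (b) $L_1$-smoothness: $\max\{\|\nabla_yf(x_a,y_a)-\nabla_yf(x_b,y_b)\|,\|\nabla_xf(x_a,y_a)-\nabla_xf(x_b,y_b)\|\}\le L_1(\|x_a-x_b\|+\|y_a-y_b\|)$ for all $x_a,x_b,y_a,y_b$. (c) $f$ has a saddle point, $\min_{x'}f(x',y)$ is attained for every $y$, and $\max_{y'}f(x,y')$ is attained for every $x$. Let $f_0,f_1,f_2,\dots$ be an arbitrary sequence of functions satisfying (a), (b), (c) with the same constants $\mu_1,\mu_2,L_1$. Write $g^*_t(x,y)=\max_{y'}f_t(x,y')-\min_{x'}f_t(x',y)$ for the dynamic gap functions. Online AGDA has parameters $\tau_1=\frac{\mu_2^2}{18L_1^3}$, $\tau_2=\frac1{L_1}$,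 $\rho$ and $\beta$, where $1-\frac{\mu_1\mu_2^2}{36L_1^3}\le\rho<1$ and, with $L=L_1+L_1^2/\mu_2$, $$\beta\ \ge\ \frac{1}{2\min\{\mu_1,\mu_2\}}\max\Big\{(4L_1^2\tau_1^2+1)\frac{2L^2}{\mu_1},\ 10(4L_1^2\tau_1^2+3)\frac{2L_1^2}{\mu_2}\Big\}.$$ From an arbitrary $z_0=(x_0,y_0)$, in round $t$ it plays $z_t=(x_t,y_t)$, observes $f_t$, sets $$K_t=\max\Big\{1,\Big\lceil\log_\rho\frac{g^*_t(z_t)}{4\beta\big(\max_yf_t(x_t,y)-\min_x\max_yf_t(x,y)+\frac{1}{10}(\max_yf_t(x_t,y)-f_t(x_t,y_t))\big)}\Big\rceil\Big\}$$ (with $K_t=1$ if $z_t$ is a saddle point of $f_t$), sets $(x_{t,0},y_{t,0})=z_t$, performs for $k=0,\dots,K_t-1$ the steps $x_{t,k+1}=x_{t,k}-\tau_1\nabla_xf_t(x_{t,k},y_{t,k})$, $y_{t,k+1}=y_{t,k}+\tau_2\nabla_yf_t(x_{t,k+1},y_{t,k})$, and sets $z_{t+1}=(x_{t,K_t},y_{t,K_t})$.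 For $T\ge1$ let $\text{Dual-Gap}_T=\sum_{t=1}^Tg^*_t(z_t)$. For arbitrary selections $x^*_t(y)\in\operatorname{argmin}_xf_t(x,y)$ and $y^*_t(x)\in\operatorname{argmax}_yf_t(x,y)$ let $$U_T=\sum_{t=1}^T\sup_z\big(g^*_{t+1}(z)-g^*_t(z)\big),\qquad V_T'=\sum_{t=1}^T\sup_{x,y}|f_t(x,y)-f_{t-1}(x,y)|,\qquad \Delta_T=\sum_{t=1}^T\|z_{t+1}-z_t\|,$$ $$C_T=\sum_{t=1}^T\big(\|x^*_{t+1}(y_{t+1})-x^*_t(y_t)\|+\|y^*_{t+1}(x_{t+1})-y^*_t(x_t)\|\big),$$ $$C_T'=\sum_{t=1}^T\big(\|x^*_{t+1}(y_{t+1})-x^*_t(y_{t+1})\|+\|y^*_{t+1}(x_{t+1})-y^*_t(x_{t+1})\|\big),$$ where the suprema may be $+\infty$. Then there are constants $\beta_0$ and $C>0$, depending only on $\mu_1,\mu_2,L_1$, such that for all $m,n$, all such sequences, parameters, starting points and selections, and all $T\ge1$: 1. if moreover $\beta\ge\beta_0$, then $\text{Dual-Gap}_T\le U_T+2\big(g^*_1(z_1)-g^*_T(z_{T+1})\big)$;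 2. $\text{Dual-Gap}_T\le 2\big(g^*_1(z_1)-g^*_T(z_{T+1})\big)+C\min\{U_T,\ V_T'+\Delta_T+C_T,\ V_T'+C_T'\}$. -/

import Mathlib

noncomputable section

open Finset

/-- `ℝᵈ` with the Euclidean norm. -/
abbrev Euc (d : ℕ) : Type := EuclideanSpace ℝ (Fin d)

variable {m n : ℕ}

/-- The partial gradient `∇ₓ f(x, y)`. -/
def gradX (f : Euc m → Euc n → ℝ) (x : Euc m) (y : Euc n) : Euc m :=
  gradient (fun x' => f x' y) x

/-- The partial gradient `∇_y f(x, y)`. -/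
def gradY (f : Euc m → Euc n → ℝ) (x : Euc m) (y : Euc n) : Euc n :=
  gradient (fun y' => f x y') y

/-- `max_y f(x, y)` (attained under `SaddleAssumption`). -/
def maxY (f : Euc m → Euc n → ℝ) (x : Euc m) : ℝ := ⨆ y, f x y

/-- `min_x f(x, y)` (attained under `SaddleAssumption`). -/
def minX (f : Euc m → Euc n → ℝ) (y : Euc n) : ℝ := ⨅ x, f x y

/-- `min_x max_y f(x, y)` (attained under `SaddleAssumption`). -/
def minMax (f : Euc m → Euc n → ℝ) : ℝ := ⨅ x, maxY f x

/-- A continuously differentiable function satisfying the two-sided Polyak-Łojasiewicz condition. -/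
structure TwoSidedPL (f : Euc m → Euc n → ℝ) (μ₁ μ₂ : ℝ) : Prop where
  contDiff : ContDiff ℝ 1 (fun p : Euc m × Euc n => f p.1 p.2)
  pl_x : ∀ x y, 2 * μ₁ * (f x y - minX f y) ≤ ‖gradX f x y‖ ^ 2
  pl_y : ∀ x y, 2 * μ₂ * (maxY f x - f x y) ≤ ‖gradY f x y‖ ^ 2

/-- `L₁`-smoothness in the two blocks of variables. -/
def BlockSmooth (f : Euc m → Euc n → ℝ) (L₁ : ℝ) : Prop :=
  ∀ xa xb ya yb,
    max ‖gradY f xa ya - gradY f xb yb‖ ‖gradX f xa ya - gradX f xb yb‖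
      ≤ L₁ * (‖xa - xb‖ + ‖ya - yb‖)

/-- There is a saddle point, each `min_x f(x, y)` is attained and each `max_y f(x, y)` is attained. -/
structure SaddleAssumption (f : Euc m → Euc n → ℝ) : Prop where
  saddle : ∃ x y, IsSaddlePointOn Set.univ Set.univ f x y
  argmin : ∀ y, ∃ x, IsMinOn (fun x' => f x' y) Set.univ x
  argmax : ∀ x, ∃ y, IsMaxOn (fun y' => f x y') Set.univ y

/-- The dynamic gap function `g*(x, y) = max_{y'} f(x, y') - min_{x'} f(x', y)`. -/
def gapFn (f : Euc m → Euc n → ℝ) (z : Euc m × Euc n) : ℝ := maxY f z.1 - minX f z.2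

/-- One step of alternating gradient descent ascent. -/
def agdaStep (τ₁ τ₂ : ℝ) (f : Euc m → Euc n → ℝ) (z : Euc m × Euc n) : Euc m × Euc n :=
  let x' := z.1 - τ₁ • gradX f z.1 z.2
  (x', z.2 + τ₂ • gradY f x' z.2)

/-- The adaptive inner-loop length
`K = max {1, ⌈log_ρ (g*(z) / (4 β (max_y f(x, y) - min_x max_y f + (max_y f(x, y) - f(x, y)) / 10)))⌉}`.
At a saddle point the quotient is `0 / 0`; there `K = 1`, and the iterates do not move. -/
def innerLength (ρ β : ℝ) (f : Euc m → Euc n → ℝ) (z : Euc m × Euc n) : ℕ :=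
  max 1 ⌈Real.logb ρ (gapFn f z /
    (4 * β * ((maxY f z.1 - minMax f) + (maxY f z.1 - f z.1 z.2) / 10)))⌉₊

/-- The plays `z_t = (x_t, y_t)` of online AGDA started at `z₀`: having observed `f_t`, run
`K_t` alternating gradient descent ascent steps on `f_t` from `z_t` to obtain `z_{t+1}`. -/
def onlineAGDA (τ₁ τ₂ ρ β : ℝ) (f : ℕ → Euc m → Euc n → ℝ) (z₀ : Euc m × Euc n) :
    ℕ → Euc m × Euc n
  | 0 => z₀
  | t + 1 =>
    (agdaStep τ₁ τ₂ (f t))^[innerLength ρ β (f t) (onlineAGDA τ₁ τ₂ ρ β f z₀ t)]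
      (onlineAGDA τ₁ τ₂ ρ β f z₀ t)

/-- The constant `β` bounding the duality gap along AGDA:
`max {(4L₁²τ₁²+1)·2L²/μ₁, 10(4L₁²τ₁²+3)·2L₁²/μ₂} / (2 min {μ₁, μ₂})`, with `L = L₁ + L₁²/μ₂`. -/
def agdaBeta (μ₁ μ₂ L₁ τ₁ : ℝ) : ℝ :=
  max ((4 * L₁ ^ 2 * τ₁ ^ 2 + 1) * (2 * (L₁ + L₁ ^ 2 / μ₂) ^ 2 / μ₁))
    (10 * (4 * L₁ ^ 2 * τ₁ ^ 2 + 3) * (2 * L₁ ^ 2 / μ₂)) / (2 * min μ₁ μ₂)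

/-- The cumulative duality gap `∑_{t=1}^T g*_t(z_t)`. -/
def dualGap (f : ℕ → Euc m → Euc n → ℝ) (z : ℕ → Euc m × Euc n) (T : ℕ) : ℝ :=
  ∑ t ∈ Icc 1 T, gapFn (f t) (z t)

/-- `U_T = ∑_{t=1}^T sup_z (g*_{t+1}(z) - g*_t(z))`, possibly `+∞`. -/
def varU (f : ℕ → Euc m → Euc n → ℝ) (T : ℕ) : EReal :=
  ∑ t ∈ Icc 1 T, ⨆ z : Euc m × Euc n, ((gapFn (f (t + 1)) z - gapFn (f t) z : ℝ) : EReal)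

/-- `V'_T = ∑_{t=1}^T sup_{x,y} |f_t(x, y) - f_{t-1}(x, y)|`, possibly `+∞`. -/
def varV (f : ℕ → Euc m → Euc n → ℝ) (T : ℕ) : EReal :=
  ∑ t ∈ Icc 1 T, ⨆ z : Euc m × Euc n, ((|f t z.1 z.2 - f (t - 1) z.1 z.2| : ℝ) : EReal)

/-- `Δ_T = ∑_{t=1}^T ‖(x_{t+1}, y_{t+1}) - (x_t, y_t)‖`, in the Euclidean norm of the product. -/
def pathLen (z : ℕ → Euc m × Euc n) (T : ℕ) : ℝ :=
  ∑ t ∈ Icc 1 T, ‖WithLp.toLp 2 (z (t + 1) - z t)‖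

/-- `C_T`, for selections `xs t y ∈ argmin_x f_t(x, y)` and `ys t x ∈ argmax_y f_t(x, y)`. -/
def varC (xs : ℕ → Euc n → Euc m) (ys : ℕ → Euc m → Euc n) (z : ℕ → Euc m × Euc n) (T : ℕ) : ℝ :=
  ∑ t ∈ Icc 1 T, (‖xs (t + 1) (z (t + 1)).2 - xs t (z t).2‖
    + ‖ys (t + 1) (z (t + 1)).1 - ys t (z t).1‖)

/-- `C'_T`, for selections `xs t y ∈ argmin_x f_t(x, y)` and `ys t x ∈ argmax_y f_t(x, y)`. -/
def varC' (xs : ℕ → Euc n → Euc m) (ys : ℕ → Euc m → Euc n) (z : ℕ → Euc m × Euc n) (T : ℕ) : ℝ :=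
  ∑ t ∈ Icc 1 T, (‖xs (t + 1) (z (t + 1)).2 - xs t (z (t + 1)).2‖
    + ‖ys (t + 1) (z (t + 1)).1 - ys t (z (t + 1)).1‖)

end

/-! Write `s t` for the gap of `f t` at `z t` and `h t` for its gap at `z (t + 1)`. Within a round,
alternating steps contract the potential `a + b / 10`, where `a` is the primal suboptimality and `b`
the inner suboptimality in `y`. The gap is at most `2 * agdaBeta` times the potential, so the choice
of `K_t` gives `2 * β * h t ≤ agdaBeta * s t`, hence `2 * h t ≤ s t` (`gapFn_innerLoop_le`).

Between rounds, `s (t + 1) - h t` is the change of the gap function at the fixed point `z (t + 1)`.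
It is bounded by the `t`-th term of `U`, and also by twice the sup-distance of consecutive
functions. Summing the halving recursion yields the second claim; the path and selection terms are
nonnegative and need no further analysis.

The first claim has coefficient 1 in front of `U`, which halving alone does not give. There the
supremum is tested away from `z (t + 1)`: moving along the new gradients raises the new gap by a
fixed fraction `c` of itself, at the cost of one more old gap (`exists_gapFn_sub_ge`). For large `β`
the old gaps are small enough to be paid for by the surplus `c`. -/

noncomputable section

open Finset

/-! ### Taylor bounds and quadratic growth under the PL inequality. -/

section Descent

variable {E : Type*} [NormedAddCommGroup E] [InnerProductSpace ℝ E] [CompleteSpace E]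

/-- The quadratic bound on the Taylor remainder of a function with Lipschitz gradient. -/
theorem abs_sub_inner_gradient_le {h : E → ℝ} {L : ℝ} (hd : Differentiable ℝ h)
    (hL : ∀ a b, ‖gradient h a - gradient h b‖ ≤ L * ‖a - b‖) (x d : E) :
    |h (x + d) - h x - inner ℝ (gradient h x) d| ≤ L / 2 * ‖d‖ ^ 2 := by
  have hder : ∀ t : ℝ, HasDerivAt (fun t : ℝ => h (x + t • d) - h x - t * inner ℝ (gradient h x) d)
      (inner ℝ (gradient h (x + t • d) - gradient h x) d) t := by
    intro t
    have h1 : HasDerivAt (fun t : ℝ => x + t • d) d t := by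
      simpa using ((hasDerivAt_id t).smul_const d).const_add x
    have h2 := (hd (x + t • d)).hasFDerivAt.comp_hasDerivAt t h1
    rw [← inner_gradient_left (f := h)] at h2
    have h3 := (h2.sub_const (h x)).sub ((hasDerivAt_id t).mul_const (inner ℝ (gradient h x) d))
    rw [inner_sub_left]
    refine (h3.congr_deriv ?_)
    simp
  have key := image_norm_le_of_norm_deriv_right_le_deriv_boundary (a := 0) (b := 1)
    (f := fun t : ℝ => h (x + t • d) - h x - t * inner ℝ (gradient h x) d)
    (f' := fun t => inner ℝ (gradient h (x + t • d) - gradient h x) d)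
    (B := fun t => L / 2 * ‖d‖ ^ 2 * t ^ 2) (B' := fun t => L * ‖d‖ ^ 2 * t)
    (fun t _ => (hder t).continuousAt.continuousWithinAt)
    (fun t _ => (hder t).hasDerivWithinAt) (by simp)
    (fun t => by
      have := ((hasDerivAt_id t).pow 2).const_mul (L / 2 * ‖d‖ ^ 2)
      refine this.congr_deriv ?_
      simp only [id, Nat.cast_ofNat]
      ring)
    (fun t ht => by
      have h1 := hL (x + t • d) x
      rw [add_sub_cancel_left, norm_smul, Real.norm_of_nonneg ht.1] at h1
      refine (norm_inner_le_norm _ _).trans ?_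
      nlinarith [norm_nonneg d, mul_le_mul_of_nonneg_right h1 (norm_nonneg d)])
    (x := 1) (by simp)
  simpa using key

/-- Quadratic growth of a smooth function satisfying the Polyak-Łojasiewicz inequality: some
maximizer lies within a distance controlled by the suboptimality. -/
theorem exists_maximizer_norm_sub_sq_le [ProperSpace E] {h : E → ℝ} {L μ M : ℝ}
    (hμ : 0 < μ) (hμL : μ ≤ L) (hc : Continuous h)
    (hL : ∀ a d, |h (a + d) - h a - inner ℝ (gradient h a) d| ≤ L / 2 * ‖d‖ ^ 2)
    (hM : ∀ a, h a ≤ M) (hpl : ∀ a, 2 * μ * (M - h a) ≤ ‖gradient h a‖ ^ 2) (y : E) :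
    ∃ w, h w = M ∧ μ * ‖y - w‖ ^ 2 ≤ 3 * (M - h y) := by
  -- By PL, `√(M - h)` has slope at least `√(μ / 2)` off the maximizers. Penalizing distance to `y`
  -- with the smaller slope `√(μ / 3)` forces a minimizer of the sum to maximize `h`, with slack for
  -- a finite gradient step.
  obtain ⟨c, hc0, hc2⟩ : ∃ c : ℝ, 0 < c ∧ c ^ 2 = μ / 3 :=
    ⟨√(μ / 3), by positivity, Real.sq_sqrt (by positivity)⟩
  obtain ⟨w, hw⟩ := Continuous.exists_forall_le (f := fun w => √(M - h w) + c * ‖w - y‖)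
    (by fun_prop) (by
      refine Filter.tendsto_atTop_mono (fun w => le_add_of_nonneg_left (Real.sqrt_nonneg _)) ?_
      refine Filter.Tendsto.const_mul_atTop hc0 ?_
      simpa [dist_eq_norm] using tendsto_dist_right_cocompact_atTop y)
  have hL0 : 0 < L := hμ.trans_le hμL
  have hwM : h w = M := by
    by_contra hne
    have hD : 0 < M - h w := by
      have := lt_of_le_of_ne (hM w) hne
      linarith
    set g := gradient h w with hg
    have hg2 := hpl w
    set t : ℝ := 1 / (5 * L) with ht
    have ht0 : 0 < t := by positivity
    have htL : L * t = 1 / 5 := by rw [ht]; field_simp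
    have hstep := (abs_le.1 (hL w (t • g))).1
    rw [← hg, inner_smul_right, real_inner_self_eq_norm_sq, norm_smul,
      Real.norm_of_nonneg ht0.le] at hstep
    have hgpos : 0 < ‖g‖ ^ 2 := lt_of_lt_of_le (by positivity) hg2
    set D := M - h w
    set D' := M - h (w + t • g) with hD'
    have hD'0 : 0 ≤ D' := by have := hM (w + t • g); rw [hD']; linarith
    have hD'D : D' ≤ D - 9 / 10 * t * ‖g‖ ^ 2 := by
      have : L / 2 * (t * ‖g‖) ^ 2 = (L * t) * (t * ‖g‖ ^ 2) / 2 := by ring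
      rw [this, htL] at hstep
      simp only [D, D']
      linarith
    have h1 := hw (w + t • g)
    have h2 : ‖w + t • g - y‖ ≤ ‖w - y‖ + t * ‖g‖ := by
      have : w + t • g - y = (w - y) + t • g := by abel
      rw [this]
      refine (norm_add_le _ _).trans ?_
      rw [norm_smul, Real.norm_of_nonneg ht0.le]
    have h3 : √D ≤ √D' + c * t * ‖g‖ := by
      have := mul_le_mul_of_nonneg_left h2 hc0.le
      simp only [D, D']
      nlinarith
    have hs : √D ^ 2 = D := Real.sq_sqrt hD.le
    have hs' : √D' ^ 2 = D' := Real.sq_sqrt hD'0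
    have hsg : c * √D ≤ 41 / 100 * ‖g‖ := by
      refine le_of_sq_le_sq ?_ (by positivity)
      rw [mul_pow, hc2, hs]
      nlinarith
    have hc2t : c ^ 2 * t ≤ 1 / 15 := by rw [hc2]; nlinarith
    have hs's : √D' ≤ √D := Real.sqrt_le_sqrt (by nlinarith [mul_pos ht0 hgpos])
    have htg : 0 < t * ‖g‖ ^ 2 := mul_pos ht0 hgpos
    -- Squaring leaves `9/10 ≤ 82/100 + 1/15` in units of `t * ‖g‖ ^ 2`, which is false.
    have hsq := pow_le_pow_left₀ (Real.sqrt_nonneg D) h3 2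
    have e1 : c * t * ‖g‖ * √D' ≤ 41 / 100 * (t * ‖g‖ ^ 2) := by
      have : c * √D' ≤ 41 / 100 * ‖g‖ := (mul_le_mul_of_nonneg_left hs's hc0.le).trans hsg
      nlinarith [mul_le_mul_of_nonneg_right this (by positivity : 0 ≤ t * ‖g‖)]
    have e2 : (c * t * ‖g‖) ^ 2 ≤ 1 / 15 * (t * ‖g‖ ^ 2) := by
      nlinarith [mul_le_mul_of_nonneg_right hc2t htg.le]
    nlinarith
  refine ⟨w, hwM, ?_⟩
  have h1 := hw y
  simp only [hwM, sub_self, Real.sqrt_zero, zero_add, norm_zero, mul_zero, add_zero] at h1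
  have h2 : (c * ‖w - y‖) ^ 2 ≤ √(M - h y) ^ 2 :=
    pow_le_pow_left₀ (by positivity) h1 2
  rw [Real.sq_sqrt (by linarith [hM y]), mul_pow, hc2, norm_sub_rev] at h2
  linarith

end Descent

/-! ### Saddle values and regularity of the primal function. -/

section Regularity

variable {m n : ℕ}

/-- Two-sided PL, smooth functions with a saddle point and attained partial extrema. -/
structure SmoothPLSaddle (f : Euc m → Euc n → ℝ) (μ₁ μ₂ L₁ : ℝ) : Prop where
  mu_x_pos : 0 < μ₁
  mu_y_pos : 0 < μ₂
  mu_x_le : μ₁ ≤ L₁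
  mu_y_le : μ₂ ≤ L₁
  pl : TwoSidedPL f μ₁ μ₂
  smooth : BlockSmooth f L₁
  saddle : SaddleAssumption f

/-- The game with the roles of the two players exchanged. -/
def swapGame (f : Euc m → Euc n → ℝ) : Euc n → Euc m → ℝ := fun y x => -f x y

theorem maxY_eq_of_isMaxOn {f : Euc m → Euc n → ℝ} {x : Euc m} {y : Euc n}
    (h : IsMaxOn (fun y' => f x y') Set.univ y) : maxY f x = f x y :=
  le_antisymm (ciSup_le fun y' => h (Set.mem_univ y'))
    (le_ciSup (f := fun y' => f x y') ⟨f x y, by rintro _ ⟨y', rfl⟩; exact h (Set.mem_univ y')⟩ y)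

theorem minX_eq_of_isMinOn {f : Euc m → Euc n → ℝ} {x : Euc m} {y : Euc n}
    (h : IsMinOn (fun x' => f x' y) Set.univ x) : minX f y = f x y :=
  le_antisymm
    (ciInf_le (f := fun x' => f x' y) ⟨f x y, by rintro _ ⟨x', rfl⟩; exact h (Set.mem_univ x')⟩ x)
    (le_ciInf fun x' => h (Set.mem_univ x'))

theorem gradient_neg_fun {d : ℕ} (h : Euc d → ℝ) (x : Euc d) :
    gradient (fun x => -h x) x = -gradient h x := by
  simp [gradient]

theorem gradX_swapGame (f : Euc m → Euc n → ℝ) (x : Euc m) (y : Euc n) :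
    gradX (swapGame f) y x = -gradY f x y :=
  gradient_neg_fun (fun y' => f x y') y

theorem gradY_swapGame (f : Euc m → Euc n → ℝ) (x : Euc m) (y : Euc n) :
    gradY (swapGame f) y x = -gradX f x y :=
  gradient_neg_fun (fun x' => f x' y) x

namespace SmoothPLSaddle

variable {f : Euc m → Euc n → ℝ} {μ₁ μ₂ L₁ : ℝ}

theorem smooth_pos (hf : SmoothPLSaddle f μ₁ μ₂ L₁) : 0 < L₁ := hf.mu_x_pos.trans_le hf.mu_x_le

theorem le_maxY (hf : SmoothPLSaddle f μ₁ μ₂ L₁) (x : Euc m) (y : Euc n) : f x y ≤ maxY f x := by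
  obtain ⟨w, hw⟩ := hf.saddle.argmax x
  rw [maxY_eq_of_isMaxOn hw]
  exact hw (Set.mem_univ y)

theorem minX_le (hf : SmoothPLSaddle f μ₁ μ₂ L₁) (x : Euc m) (y : Euc n) : minX f y ≤ f x y := by
  obtain ⟨w, hw⟩ := hf.saddle.argmin y
  rw [minX_eq_of_isMinOn hw]
  exact hw (Set.mem_univ x)

theorem exists_eq_maxY (hf : SmoothPLSaddle f μ₁ μ₂ L₁) (x : Euc m) : ∃ y, f x y = maxY f x :=
  (hf.saddle.argmax x).imp fun _ h => (maxY_eq_of_isMaxOn h).symm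

theorem exists_eq_minX (hf : SmoothPLSaddle f μ₁ μ₂ L₁) (y : Euc n) : ∃ x, f x y = minX f y :=
  (hf.saddle.argmin y).imp fun _ h => (minX_eq_of_isMinOn h).symm

theorem maxY_swapGame (hf : SmoothPLSaddle f μ₁ μ₂ L₁) (y : Euc n) :
    maxY (swapGame f) y = -minX f y := by
  obtain ⟨w, hw⟩ := hf.saddle.argmin y
  rw [minX_eq_of_isMinOn hw]
  exact maxY_eq_of_isMaxOn (f := swapGame f) hw.neg

theorem minX_swapGame (hf : SmoothPLSaddle f μ₁ μ₂ L₁) (x : Euc m) :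
    minX (swapGame f) x = -maxY f x := by
  obtain ⟨w, hw⟩ := hf.saddle.argmax x
  rw [maxY_eq_of_isMaxOn hw]
  exact minX_eq_of_isMinOn (f := swapGame f) hw.neg

/-- The hypotheses are symmetric under exchanging the players and negating, so every primal estimate
has a dual one. -/
theorem swap (hf : SmoothPLSaddle f μ₁ μ₂ L₁) : SmoothPLSaddle (swapGame f) μ₂ μ₁ L₁ where
  mu_x_pos := hf.mu_y_pos
  mu_y_pos := hf.mu_x_pos
  mu_x_le := hf.mu_y_le
  mu_y_le := hf.mu_x_le
  pl :=
    { contDiff := (hf.pl.contDiff.comp (contDiff_snd.prodMk contDiff_fst)).neg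
      pl_x := fun y x => by
        rw [gradX_swapGame, norm_neg, hf.minX_swapGame]
        refine le_trans (le_of_eq ?_) (hf.pl.pl_y x y)
        simp only [swapGame]
        ring
      pl_y := fun y x => by
        rw [gradY_swapGame, norm_neg, hf.maxY_swapGame]
        refine le_trans (le_of_eq ?_) (hf.pl.pl_x x y)
        simp only [swapGame]
        ring }
  smooth := fun ya yb xa xb => by
    have h := hf.smooth xa xb ya yb
    simp only [gradX_swapGame, gradY_swapGame, ← neg_sub', norm_neg]
    rw [max_comm, add_comm]
    exact h
  saddle :=
    { saddle := by
        obtain ⟨a, b, h⟩ := hf.saddle.saddle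
        exact ⟨b, a, fun y hy x hx => neg_le_neg (h x hx y hy)⟩
      argmin := fun x => (hf.saddle.argmax x).imp fun _ h => h.neg
      argmax := fun y => (hf.saddle.argmin y).imp fun _ h => h.neg }

theorem exists_saddle_value (hf : SmoothPLSaddle f μ₁ μ₂ L₁) :
    ∃ a b, (∀ x y, f a y ≤ f x b) ∧ maxY f a = f a b ∧ minX f b = f a b ∧ minMax f = f a b := by
  obtain ⟨a, b, h⟩ := hf.saddle.saddle
  have h' : ∀ x y, f a y ≤ f x b := fun x y => h x (Set.mem_univ x) y (Set.mem_univ y)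
  have hmax : maxY f a = f a b := maxY_eq_of_isMaxOn (fun y _ => h' a y)
  have hle : ∀ x, f a b ≤ maxY f x := fun x => (h' x b).trans (hf.le_maxY x b)
  refine ⟨a, b, h', hmax, minX_eq_of_isMinOn (fun x _ => h' x b), le_antisymm ?_ (le_ciInf hle)⟩
  rw [← hmax]
  exact ciInf_le (f := fun x => maxY f x) ⟨f a b, by rintro _ ⟨x, rfl⟩; exact hle x⟩ a

theorem minMax_le (hf : SmoothPLSaddle f μ₁ μ₂ L₁) (x : Euc m) : minMax f ≤ maxY f x := by
  obtain ⟨a, b, h, -, -, h4⟩ := hf.exists_saddle_value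
  rw [h4]
  exact (h x b).trans (hf.le_maxY x b)

theorem minX_le_minMax (hf : SmoothPLSaddle f μ₁ μ₂ L₁) (y : Euc n) : minX f y ≤ minMax f := by
  obtain ⟨a, b, h, -, -, h4⟩ := hf.exists_saddle_value
  rw [h4]
  exact (hf.minX_le a y).trans (h a y)

theorem minMax_swapGame (hf : SmoothPLSaddle f μ₁ μ₂ L₁) : minMax (swapGame f) = -minMax f := by
  obtain ⟨a, b, -, -, h3, h4⟩ := hf.exists_saddle_value
  refine le_antisymm ?_ ?_
  · rw [h4, ← h3, ← hf.maxY_swapGame]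
    exact hf.swap.minMax_le b
  · refine le_ciInf fun y => ?_
    rw [hf.maxY_swapGame]
    exact neg_le_neg (hf.minX_le_minMax y)

/-- The gap function is the sum of the suboptimality gaps of the two players. -/
theorem gapFn_eq (hf : SmoothPLSaddle f μ₁ μ₂ L₁) (z : Euc m × Euc n) :
    gapFn f z = (maxY f z.1 - minMax f) + (maxY (swapGame f) z.2 - minMax (swapGame f)) := by
  rw [hf.maxY_swapGame, hf.minMax_swapGame, gapFn]
  ring

theorem gapFn_nonneg (hf : SmoothPLSaddle f μ₁ μ₂ L₁) (z : Euc m × Euc n) : 0 ≤ gapFn f z :=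
  sub_nonneg.2 ((hf.minX_le_minMax z.2).trans (hf.minMax_le z.1))

theorem exists_gapFn_eq_zero (hf : SmoothPLSaddle f μ₁ μ₂ L₁) : ∃ z, gapFn f z = 0 := by
  obtain ⟨a, b, -, h2, h3, -⟩ := hf.exists_saddle_value
  exact ⟨(a, b), by simp [gapFn, h2, h3]⟩

theorem gradX_sub_le (hf : SmoothPLSaddle f μ₁ μ₂ L₁) (xa xb : Euc m) (ya yb : Euc n) :
    ‖gradX f xa ya - gradX f xb yb‖ ≤ L₁ * (‖xa - xb‖ + ‖ya - yb‖) :=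
  (le_max_right _ _).trans (hf.smooth xa xb ya yb)

theorem gradY_sub_le (hf : SmoothPLSaddle f μ₁ μ₂ L₁) (xa xb : Euc m) (ya yb : Euc n) :
    ‖gradY f xa ya - gradY f xb yb‖ ≤ L₁ * (‖xa - xb‖ + ‖ya - yb‖) :=
  (le_max_left _ _).trans (hf.smooth xa xb ya yb)

theorem abs_taylor_x_le (hf : SmoothPLSaddle f μ₁ μ₂ L₁) (y : Euc n) (x d : Euc m) :
    |f (x + d) y - f x y - inner ℝ (gradX f x y) d| ≤ L₁ / 2 * ‖d‖ ^ 2 := by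
  refine abs_sub_inner_gradient_le (h := fun x' => f x' y) ?_ (fun a b => ?_) x d
  · exact (hf.pl.contDiff.differentiable one_ne_zero).comp
      (f := fun x' => (x', y)) (by fun_prop)
  · simpa [gradX] using hf.gradX_sub_le a b y y

theorem abs_taylor_y_le (hf : SmoothPLSaddle f μ₁ μ₂ L₁) (x : Euc m) (y d : Euc n) :
    |f x (y + d) - f x y - inner ℝ (gradY f x y) d| ≤ L₁ / 2 * ‖d‖ ^ 2 := by
  refine abs_sub_inner_gradient_le (h := fun y' => f x y') ?_ (fun a b => ?_) y d
  · exact (hf.pl.contDiff.differentiable one_ne_zero).comp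
      (f := fun y' => (x, y')) (by fun_prop)
  · simpa [gradY] using hf.gradY_sub_le x x a b

theorem exists_argmax_near (hf : SmoothPLSaddle f μ₁ μ₂ L₁) (x : Euc m) (y : Euc n) :
    ∃ w, f x w = maxY f x ∧ μ₂ * ‖y - w‖ ^ 2 ≤ 3 * (maxY f x - f x y) :=
  exists_maximizer_norm_sub_sq_le (h := fun y' => f x y') hf.mu_y_pos hf.mu_y_le
    (hf.pl.contDiff.continuous.comp (f := fun y' => (x, y')) (by fun_prop))
    (hf.abs_taylor_y_le x) (hf.le_maxY x) (hf.pl.pl_y x) y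

/-- The primal function `max_y f(x, y)` is smooth from above: the partial gradient at any maximizer
is a supergradient up to a quadratic term. -/
theorem maxY_add_le (hf : SmoothPLSaddle f μ₁ μ₂ L₁) {x : Euc m} {w : Euc n}
    (hw : f x w = maxY f x) (d : Euc m) :
    maxY f (x + d) ≤
      maxY f x + inner ℝ (gradX f x w) d + (L₁ + L₁ ^ 2 / μ₂) / 2 * ‖d‖ ^ 2 := by
  have hμ := hf.mu_y_pos
  have hstat : gradY f x w = 0 := by
    have h : IsLocalMax (fun y' => f x y') w :=
      Filter.Eventually.of_forall fun y' => by simpa [hw] using hf.le_maxY x y'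
    simp [gradY, gradient, h.fderiv_eq_zero]
  have h1 := (abs_le.1 (hf.abs_taylor_x_le w x d)).2
  have h2 := hf.pl.pl_y (x + d) w
  have h3 := hf.gradY_sub_le (x + d) x w w
  rw [hstat, sub_zero, sub_self, norm_zero, add_zero, add_sub_cancel_left] at h3
  have h4 := pow_le_pow_left₀ (norm_nonneg _) h3 2
  -- The gradient in `y` at `w` vanishes over `x`, so it has norm at most `L₁ * ‖d‖` over `x + d`;
  -- PL in `y` then bounds how far `w` is from optimal there.
  have h5 : maxY f (x + d) - f (x + d) w ≤ L₁ ^ 2 / μ₂ / 2 * ‖d‖ ^ 2 := by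
    have : L₁ ^ 2 / μ₂ / 2 * ‖d‖ ^ 2 = (L₁ * ‖d‖) ^ 2 / (2 * μ₂) := by field_simp
    rw [this, le_div_iff₀ (by positivity)]
    linarith
  linarith

theorem le_maxY_add (hf : SmoothPLSaddle f μ₁ μ₂ L₁) {x : Euc m} {w : Euc n}
    (hw : f x w = maxY f x) (d : Euc m) :
    maxY f x + inner ℝ (gradX f x w) d - L₁ / 2 * ‖d‖ ^ 2 ≤ maxY f (x + d) := by
  have h1 := (abs_le.1 (hf.abs_taylor_x_le w x d)).1
  have h2 := hf.le_maxY (x + d) w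
  linarith

/-- PL in `x` at `(x, w)` suffices because `minX f w` lies below the saddle value. The vector `gradX
f x w` stands in for a gradient of `maxY f`, whose differentiability is never needed. -/
theorem primal_pl (hf : SmoothPLSaddle f μ₁ μ₂ L₁) {x : Euc m} {w : Euc n}
    (hw : f x w = maxY f x) : 2 * μ₁ * (maxY f x - minMax f) ≤ ‖gradX f x w‖ ^ 2 := by
  refine le_trans ?_ (hf.pl.pl_x x w)
  rw [hw]
  have := hf.mu_x_pos
  have := hf.minX_le_minMax w
  gcongr

/-- A step of length `1 / L` against this vector cannot take `maxY f` below its minimum. -/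
theorem primal_gradient_sq_le (hf : SmoothPLSaddle f μ₁ μ₂ L₁) {x : Euc m} {w : Euc n}
    (hw : f x w = maxY f x) :
    ‖gradX f x w‖ ^ 2 ≤ 2 * (L₁ + L₁ ^ 2 / μ₂) * (maxY f x - minMax f) := by
  have hμ := hf.mu_y_pos
  have hL₁ := hf.smooth_pos
  set L := L₁ + L₁ ^ 2 / μ₂ with hL
  have hL0 : 0 < L := by positivity
  have h := hf.maxY_add_le hw (-(1 / L) • gradX f x w)
  have h0 := hf.minMax_le (x + -(1 / L) • gradX f x w)
  rw [inner_smul_right, real_inner_self_eq_norm_sq, norm_smul, norm_neg,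
    Real.norm_of_nonneg (by positivity), ← hL] at h
  have e : L / 2 * (1 / L * ‖gradX f x w‖) ^ 2 = 1 / (2 * L) * ‖gradX f x w‖ ^ 2 := by
    field_simp
  have e2 : -(1 / L) * ‖gradX f x w‖ ^ 2 = -(2 * (1 / (2 * L) * ‖gradX f x w‖ ^ 2)) := by
    field_simp
  have h3 : 1 / (2 * L) * ‖gradX f x w‖ ^ 2 ≤ maxY f x - minMax f := by linarith
  rw [one_div_mul_eq_div, div_le_iff₀ (by positivity)] at h3
  linarith

end SmoothPLSaddle

end Regularity

/-! ### Contraction of the potential and its comparison with the gap. -/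

section Potential

variable {m n : ℕ}

/-- The potential `max_y f(x, y) - min_x max_y f + (max_y f(x, y) - f(x, y)) / 10`. -/
def agdaPotential (f : Euc m → Euc n → ℝ) (z : Euc m × Euc n) : ℝ :=
  (maxY f z.1 - minMax f) + (maxY f z.1 - f z.1 z.2) / 10

theorem agdaBeta_pos {μ₁ μ₂ L₁ : ℝ} (hμ₁ : 0 < μ₁) (hμ₂ : 0 < μ₂) (hL₁ : 0 < L₁) (τ₁ : ℝ) :
    0 < agdaBeta μ₁ μ₂ L₁ τ₁ := by
  refine div_pos (lt_max_of_lt_left ?_) (by have := lt_min hμ₁ hμ₂; positivity)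
  positivity

namespace SmoothPLSaddle

variable {f : Euc m → Euc n → ℝ} {μ₁ μ₂ L₁ : ℝ}

theorem agdaPotential_nonneg (hf : SmoothPLSaddle f μ₁ μ₂ L₁) (z : Euc m × Euc n) :
    0 ≤ agdaPotential f z := by
  have h1 := hf.minMax_le z.1
  have h2 := hf.le_maxY z.1 z.2
  rw [agdaPotential]
  linarith

/-- Ensures that the argument of `log_ρ` is positive wherever the potential is. -/
theorem agdaPotential_le_gapFn (hf : SmoothPLSaddle f μ₁ μ₂ L₁) (z : Euc m × Euc n) :
    agdaPotential f z ≤ 11 / 10 * gapFn f z := by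
  have h1 := hf.minX_le_minMax z.2
  have h2 := hf.minX_le z.1 z.2
  rw [agdaPotential, gapFn]
  linarith

theorem gradX_sub_sq_le (hf : SmoothPLSaddle f μ₁ μ₂ L₁) {x : Euc m} {y w : Euc n}
    (hw : μ₂ * ‖y - w‖ ^ 2 ≤ 3 * (maxY f x - f x y)) :
    μ₂ * ‖gradX f x w - gradX f x y‖ ^ 2 ≤ 3 * L₁ ^ 2 * (maxY f x - f x y) := by
  have h := hf.gradX_sub_le x x w y
  rw [sub_self, norm_zero, zero_add, norm_sub_rev w y] at h
  have h2 := pow_le_pow_left₀ (norm_nonneg _) h 2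
  have hμ := hf.mu_y_pos
  nlinarith [mul_le_mul_of_nonneg_left h2 hμ.le, mul_le_mul_of_nonneg_left hw (sq_nonneg L₁)]

/-- The gap is `b + (f x y - minX f y)`. PL in `x` bounds the second term by `‖∇ₓf(x, y)‖²`, which
splits into the primal gradient at a nearby maximizer, controlled by `a`, and a difference
controlled by `b` through quadratic growth. -/
theorem gapFn_le_potential (hf : SmoothPLSaddle f μ₁ μ₂ L₁) (τ₁ : ℝ) (z : Euc m × Euc n) :
    gapFn f z ≤ 2 * agdaBeta μ₁ μ₂ L₁ τ₁ * agdaPotential f z := by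
  obtain ⟨x, y⟩ := z
  have hμ₁ := hf.mu_x_pos
  have hμ₂ := hf.mu_y_pos
  have hL₁ := hf.smooth_pos
  have h1L := hf.mu_x_le
  have h2L := hf.mu_y_le
  obtain ⟨w, hw, hyw⟩ := hf.exists_argmax_near x y
  have hr := hf.gradX_sub_sq_le hyw
  have hp := hf.primal_gradient_sq_le hw
  have hq := hf.pl.pl_x x y
  have ha := hf.minMax_le x
  have hb := hf.le_maxY x y
  set L := L₁ + L₁ ^ 2 / μ₂ with hL
  have hL₁L : L₁ ≤ L := by rw [hL]; have : 0 < L₁ ^ 2 / μ₂ := by positivity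
                           linarith
  set M := min μ₁ μ₂ with hM
  have hM0 : 0 < M := lt_min hμ₁ hμ₂
  have hML : M ≤ L₁ := (min_le_left _ _).trans h1L
  have hM1 : M ≤ μ₁ := min_le_left _ _
  have htri : ‖gradX f x y‖ ^ 2 ≤
      2 * ‖gradX f x w‖ ^ 2 + 2 * ‖gradX f x w - gradX f x y‖ ^ 2 := by
    have h := parallelogram_law_with_norm ℝ (gradX f x w) (gradX f x w - gradX f x y)
    rw [sub_sub_cancel] at h
    nlinarith [sq_nonneg ‖gradX f x w + (gradX f x w - gradX f x y)‖]
  have hβa : 2 * L / μ₁ ≤ 2 * agdaBeta μ₁ μ₂ L₁ τ₁ := by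
    have h1 : (4 * L₁ ^ 2 * τ₁ ^ 2 + 1) * (2 * L ^ 2 / μ₁) / (2 * M) ≤ agdaBeta μ₁ μ₂ L₁ τ₁ :=
      div_le_div_of_nonneg_right (le_max_left _ _) (by positivity)
    have h2 : 1 * (2 * L ^ 2 / μ₁) / (2 * M) ≤
        (4 * L₁ ^ 2 * τ₁ ^ 2 + 1) * (2 * L ^ 2 / μ₁) / (2 * M) := by
      gcongr
      nlinarith [mul_nonneg (sq_nonneg L₁) (sq_nonneg τ₁)]
    have h3 : 2 * L / μ₁ ≤ 2 * (1 * (2 * L ^ 2 / μ₁) / (2 * M)) := by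
      have : 2 * (1 * (2 * L ^ 2 / μ₁) / (2 * M)) = 2 * L / μ₁ * (L / M) := by field_simp
      rw [this]
      refine le_mul_of_one_le_right (by positivity) ?_
      rw [one_le_div hM0]
      linarith
    linarith
  -- The factor 10 compensates the weight `1 / 10` of `b` in the potential.
  have hβb : 10 * (1 + 3 * L₁ ^ 2 / (μ₁ * μ₂)) ≤ 2 * agdaBeta μ₁ μ₂ L₁ τ₁ := by
    have h1 : (10 * (4 * L₁ ^ 2 * τ₁ ^ 2 + 3) * (2 * L₁ ^ 2 / μ₂)) / (2 * M) ≤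
        agdaBeta μ₁ μ₂ L₁ τ₁ :=
      div_le_div_of_nonneg_right (le_max_right _ _) (by positivity)
    have h2 : 10 * 3 * (2 * L₁ ^ 2 / μ₂) / (2 * M) ≤
        (10 * (4 * L₁ ^ 2 * τ₁ ^ 2 + 3) * (2 * L₁ ^ 2 / μ₂)) / (2 * M) := by
      gcongr
      nlinarith [mul_nonneg (sq_nonneg L₁) (sq_nonneg τ₁)]
    have h3 : 10 * (1 + 3 * L₁ ^ 2 / (μ₁ * μ₂)) ≤ 2 * (10 * 3 * (2 * L₁ ^ 2 / μ₂) / (2 * M)) := by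
      have e1 : 1 ≤ L₁ ^ 2 / (M * μ₂) := by
        rw [one_le_div (by positivity), sq]
        exact mul_le_mul hML h2L hμ₂.le hL₁.le
      have e2 : L₁ ^ 2 / (μ₁ * μ₂) ≤ L₁ ^ 2 / (M * μ₂) := by gcongr
      have e3 : 2 * (10 * 3 * (2 * L₁ ^ 2 / μ₂) / (2 * M)) = 60 * (L₁ ^ 2 / (M * μ₂)) := by
        field_simp
        norm_num
      rw [e3, mul_div_assoc]
      linarith
    linarith
  set a := maxY f x - minMax f
  set b := maxY f x - f x y
  have ha0 : 0 ≤ a := sub_nonneg.2 ha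
  have hb0 : 0 ≤ b := sub_nonneg.2 hb
  have hr' : ‖gradX f x w - gradX f x y‖ ^ 2 ≤ 3 * L₁ ^ 2 / μ₂ * b := by
    rw [div_mul_eq_mul_div, le_div_iff₀ hμ₂]
    linarith
  have hc : f x y - minX f y ≤ 2 * L / μ₁ * a + 3 * L₁ ^ 2 / (μ₁ * μ₂) * b := by
    have : 2 * L / μ₁ * a + 3 * L₁ ^ 2 / (μ₁ * μ₂) * b =
        (4 * L * a + 2 * (3 * L₁ ^ 2 / μ₂ * b)) / (2 * μ₁) := by
      field_simp
      ring
    rw [this, le_div_iff₀ (by positivity)]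
    linarith
  have hg : gapFn f (x, y) = b + (f x y - minX f y) := by
    simp only [gapFn, b]
    ring
  have hP : agdaPotential f (x, y) = a + b / 10 := rfl
  rw [hg, hP]
  nlinarith [mul_le_mul_of_nonneg_right hβa ha0, mul_le_mul_of_nonneg_right hβb hb0]

theorem gradY_step_le (hf : SmoothPLSaddle f μ₁ μ₂ L₁) (x : Euc m) (y : Euc n) :
    maxY f x - f x (y + (1 / L₁) • gradY f x y) ≤ (1 - μ₂ / L₁) * (maxY f x - f x y) := by
  have hL₁ := hf.smooth_pos
  have h := (abs_le.1 (hf.abs_taylor_y_le x y ((1 / L₁) • gradY f x y))).1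
  rw [inner_smul_right, real_inner_self_eq_norm_sq, norm_smul,
    Real.norm_of_nonneg (by positivity)] at h
  have e1 : L₁ / 2 * (1 / L₁ * ‖gradY f x y‖) ^ 2 = ‖gradY f x y‖ ^ 2 / (2 * L₁) := by
    field_simp
  have e2 : 1 / L₁ * ‖gradY f x y‖ ^ 2 = 2 * (‖gradY f x y‖ ^ 2 / (2 * L₁)) := by
    field_simp
  have h2 : μ₂ / L₁ * (maxY f x - f x y) ≤ ‖gradY f x y‖ ^ 2 / (2 * L₁) := by
    rw [div_mul_eq_mul_div, div_le_div_iff₀ hL₁ (by positivity)]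
    nlinarith [mul_le_mul_of_nonneg_right (hf.pl.pl_y x y) hL₁.le]
  linarith

/-- One step of alternating gradient descent ascent contracts the potential. -/
theorem agdaPotential_step_le (hf : SmoothPLSaddle f μ₁ μ₂ L₁) {ρ : ℝ}
    (hρ : 1 - μ₁ * μ₂ ^ 2 / (36 * L₁ ^ 3) ≤ ρ) (z : Euc m × Euc n) :
    agdaPotential f (agdaStep (μ₂ ^ 2 / (18 * L₁ ^ 3)) (1 / L₁) f z) ≤ ρ * agdaPotential f z := by
  obtain ⟨x, y⟩ := z
  have hμ₁ := hf.mu_x_pos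
  have hμ₂ := hf.mu_y_pos
  have hL₁ := hf.smooth_pos
  have h1L := hf.mu_x_le
  have h2L := hf.mu_y_le
  set τ := μ₂ ^ 2 / (18 * L₁ ^ 3) with hτ
  set κ := μ₂ / L₁ with hκ
  set L := L₁ + L₁ ^ 2 / μ₂ with hL
  have hτ0 : 0 < τ := by positivity
  have hκ0 : 0 < κ := by positivity
  have hκ1 : κ ≤ 1 := (div_le_one hL₁).2 h2L
  have hτL₁ : L₁ * τ = κ ^ 2 / 18 := by rw [hτ, hκ]; field_simp
  have hτL : L * τ ≤ 1 / 9 := by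
    have : L * τ = κ ^ 2 / 18 + κ / 18 := by rw [hL, hτ, hκ]; field_simp
    nlinarith
  obtain ⟨w, hw, hyw⟩ := hf.exists_argmax_near x y
  have hr := hf.gradX_sub_sq_le hyw
  have hpl := hf.primal_pl hw
  have ha := hf.minMax_le x
  have hb := hf.le_maxY x y
  set p := gradX f x w
  set q := gradX f x y with hq
  have hG := hf.maxY_add_le hw (-(τ • q))
  have hF := (abs_le.1 (hf.abs_taylor_x_le y x (-(τ • q)))).1
  have hY := hf.gradY_step_le (x + -(τ • q)) y
  -- The step uses `q` where the primal function calls for `p`. Polarizing `⟪p, q⟫` gives descent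
  -- from `‖p‖²` and `‖q‖²` and an error `‖p - q‖²` of order `b`.
  have hrr := norm_sub_sq_real p q
  rw [inner_neg_right, inner_smul_right, norm_neg, norm_smul, Real.norm_of_nonneg hτ0.le,
    ← hL] at hG
  rw [← hκ] at hY
  rw [← hq, inner_neg_right, inner_smul_right, real_inner_self_eq_norm_sq, norm_neg, norm_smul,
    Real.norm_of_nonneg hτ0.le] at hF
  have hP1 : agdaPotential f (agdaStep τ (1 / L₁) f (x, y)) =
      (maxY f (x + -(τ • q)) - minMax f) + (maxY f (x + -(τ • q)) - f (x + -(τ • q))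
        (y + (1 / L₁) • gradY f (x + -(τ • q)) y)) / 10 := by
    simp only [agdaPotential, agdaStep, sub_eq_add_neg, q]
  have hP : agdaPotential f (x, y) = (maxY f x - minMax f) + (maxY f x - f x y) / 10 := rfl
  rw [hP1, hP]
  set G' := maxY f (x + -(τ • q))
  set a := maxY f x - minMax f with haa
  set b := maxY f x - f x y with hbb
  have ha0 : 0 ≤ a := sub_nonneg.2 ha
  have hb0 : 0 ≤ b := sub_nonneg.2 hb
  set Q := ‖q‖ ^ 2 with hQ
  have hQ0 : 0 ≤ Q := sq_nonneg _
  set R := ‖p - q‖ ^ 2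
  have hτR : τ / 2 * R ≤ κ / 12 * b := by
    have h1 : τ / 2 * R = μ₂ / (36 * L₁ ^ 3) * (μ₂ * R) := by rw [hτ]; field_simp; ring
    have h2 : κ / 12 * b = μ₂ / (36 * L₁ ^ 3) * (3 * L₁ ^ 2 * b) := by
      rw [hκ]; field_simp; ring
    rw [h1, h2]
    exact mul_le_mul_of_nonneg_left hr (by positivity)
  have hdG : G' - maxY f x ≤ -(τ * μ₁) * a + κ / 12 * b - 4 / 9 * (τ * Q) := by
    have e1 : L / 2 * (τ * ‖q‖) ^ 2 = L * τ * (τ * Q) / 2 := by rw [hQ]; ring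
    have e2 : L * τ * (τ * Q) ≤ 1 / 9 * (τ * Q) :=
      mul_le_mul_of_nonneg_right hτL (by positivity)
    have e3 : τ * (2 * μ₁ * a) ≤ τ * ‖p‖ ^ 2 := mul_le_mul_of_nonneg_left hpl hτ0.le
    have e4 : τ * R = τ * ‖p‖ ^ 2 - 2 * (τ * inner ℝ p q) + τ * Q := by rw [hrr]; ring
    rw [e1] at hG
    linarith
  have hdF : f x y - f (x + -(τ • q)) y ≤ 37 / 36 * (τ * Q) := by
    have e1 : L₁ / 2 * (τ * ‖q‖) ^ 2 = L₁ * τ * (τ * Q) / 2 := by rw [hQ]; ring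
    have e2 : L₁ * τ * (τ * Q) ≤ 1 / 18 * (τ * Q) :=
      mul_le_mul_of_nonneg_right (by rw [hτL₁]; nlinarith) (by positivity)
    rw [e1] at hF
    linarith
  have hτκ : μ₁ * τ / 2 ≤ κ / 36 := by
    have : μ₁ * τ / 2 = κ / 36 * (μ₁ * μ₂ / L₁ ^ 2) := by rw [hτ, hκ]; field_simp; norm_num
    rw [this]
    refine mul_le_of_le_one_right (by positivity) ((div_le_one (by positivity)).2 ?_)
    rw [sq]
    exact mul_le_mul h1L h2L hμ₂.le hL₁.le
  have hρ' : 1 - μ₁ * τ / 2 ≤ ρ := by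
    refine le_trans (le_of_eq ?_) hρ
    rw [hτ]
    field_simp
    ring
  have hB : G' - f (x + -(τ • q)) y ≤
      -(τ * μ₁) * a + (1 + κ / 12) * b + 7 / 12 * (τ * Q) := by linarith
  have hs := mul_le_mul_of_nonneg_left hB (sub_nonneg.2 hκ1)
  have hτQ : 0 ≤ τ * Q := by positivity
  have hτa : 0 ≤ τ * μ₁ * a := by positivity
  -- Budget: the coefficient of `b` becomes `κ/12 + (1 - κ + κ/12)/10 = 1/10 - κ/120`, below the
  -- required `1/10 - κ/360`; that of `τ * Q` is `-4/9 + 7/120 < 0`.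
  have e1 : (1 - κ) * (-(τ * μ₁) * a + (1 + κ / 12) * b + 7 / 12 * (τ * Q)) ≤
      (1 - κ + κ / 12) * b + 7 / 12 * (τ * Q) := by
    have i1 := mul_nonneg (sub_nonneg.2 hκ1) hτa
    have i2 := mul_nonneg hκ0.le hτQ
    have i3 := mul_nonneg (sq_nonneg κ) hb0
    linarith
  have e2 : (1 - μ₁ * τ / 2) * (a + b / 10) ≤ ρ * (a + b / 10) :=
    mul_le_mul_of_nonneg_right hρ' (by positivity)
  have e3 := mul_le_mul_of_nonneg_right hτκ hb0
  have e4 : 0 ≤ κ * b := by positivity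
  linarith

theorem agdaPotential_iterate_le (hf : SmoothPLSaddle f μ₁ μ₂ L₁) {ρ : ℝ} (hρ0 : 0 ≤ ρ)
    (hρ : 1 - μ₁ * μ₂ ^ 2 / (36 * L₁ ^ 3) ≤ ρ) (z : Euc m × Euc n) (k : ℕ) :
    agdaPotential f ((agdaStep (μ₂ ^ 2 / (18 * L₁ ^ 3)) (1 / L₁) f)^[k] z) ≤
      ρ ^ k * agdaPotential f z := by
  induction k with
  | zero => simp
  | succ k ih =>
    rw [Function.iterate_succ_apply', pow_succ' ρ, mul_assoc]
    exact (hf.agdaPotential_step_le hρ _).trans (mul_le_mul_of_nonneg_left ih hρ0)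

/-- The inner loop shrinks the gap function by the factor `agdaBeta / (2 β)`. -/
theorem gapFn_innerLoop_le (hf : SmoothPLSaddle f μ₁ μ₂ L₁) {ρ β : ℝ}
    (hρ : 1 - μ₁ * μ₂ ^ 2 / (36 * L₁ ^ 3) ≤ ρ) (hρ1 : ρ < 1)
    (hβ : agdaBeta μ₁ μ₂ L₁ (μ₂ ^ 2 / (18 * L₁ ^ 3)) ≤ β) (z : Euc m × Euc n) :
    2 * β * gapFn f ((agdaStep (μ₂ ^ 2 / (18 * L₁ ^ 3)) (1 / L₁) f)^[innerLength ρ β f z] z) ≤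
      agdaBeta μ₁ μ₂ L₁ (μ₂ ^ 2 / (18 * L₁ ^ 3)) * gapFn f z := by
  have hμ₁ := hf.mu_x_pos
  have hμ₂ := hf.mu_y_pos
  have hL₁ := hf.smooth_pos
  have hρ0 : 0 < ρ := by
    refine lt_of_lt_of_le (sub_pos.2 ((div_lt_one (by positivity)).2 ?_)) hρ
    have h2 : μ₂ ^ 2 ≤ L₁ ^ 2 := pow_le_pow_left₀ hμ₂.le hf.mu_y_le 2
    have := mul_le_mul hf.mu_x_le h2 (by positivity) hL₁.le
    nlinarith [pow_pos hL₁ 3]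
  set B := agdaBeta μ₁ μ₂ L₁ (μ₂ ^ 2 / (18 * L₁ ^ 3))
  have hB0 : 0 < B := agdaBeta_pos hμ₁ hμ₂ hL₁ _
  have hβ0 : 0 < β := hB0.trans_le hβ
  set K := innerLength ρ β f z with hK
  have h1 := hf.gapFn_le_potential (μ₂ ^ 2 / (18 * L₁ ^ 3))
    ((agdaStep (μ₂ ^ 2 / (18 * L₁ ^ 3)) (1 / L₁) f)^[K] z)
  have h2 := hf.agdaPotential_iterate_le hρ0.le hρ z K
  have h3 : 4 * β * (ρ ^ K * agdaPotential f z) ≤ gapFn f z := by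
    rcases (hf.agdaPotential_nonneg z).eq_or_lt with h0 | h0
    · rw [← h0, mul_zero, mul_zero]
      exact hf.gapFn_nonneg z
    have hg : 0 < gapFn f z := by linarith [hf.agdaPotential_le_gapFn z]
    -- As `ρ < 1`, rounding the exponent up only decreases the power.
    have hlog : Real.logb ρ (gapFn f z / (4 * β * agdaPotential f z)) ≤ (K : ℝ) :=
      (Nat.le_ceil _).trans (Nat.cast_le.2 (le_max_right _ _))
    have hpow := Real.rpow_le_rpow_of_exponent_ge hρ0 hρ1.le hlog
    rw [Real.rpow_logb hρ0 hρ1.ne (by positivity), Real.rpow_natCast,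
      le_div_iff₀ (by positivity)] at hpow
    linarith
  have h4 := mul_le_mul_of_nonneg_left h2 (by positivity : 0 ≤ 2 * B)
  have h5 := mul_le_mul_of_nonneg_left h3 hB0.le
  have h6 := mul_le_mul_of_nonneg_left (h1.trans h4) (by positivity : 0 ≤ 2 * β)
  linarith

/-! ### Comparing the gaps of two consecutive games. -/

variable {f' : Euc m → Euc n → ℝ}

/-- A step along the supergradient of the new primal function increases the difference of the
primal functions. -/
theorem exists_maxY_sub_ge (hf : SmoothPLSaddle f μ₁ μ₂ L₁) (hf' : SmoothPLSaddle f' μ₁ μ₂ L₁)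
    (x : Euc m) : ∃ x', (maxY f' x - maxY f x)
      + μ₁ / (8 * (L₁ + L₁ ^ 2 / μ₂)) * (maxY f' x - minMax f') - (maxY f x - minMax f) ≤
        maxY f' x' - maxY f x' := by
  have hμ₁ := hf.mu_x_pos
  have hμ₂ := hf.mu_y_pos
  have hL₁ := hf.smooth_pos
  obtain ⟨w, hw⟩ := hf.exists_eq_maxY x
  obtain ⟨w', hw'⟩ := hf'.exists_eq_maxY x
  have hp := hf.primal_gradient_sq_le hw
  have hp' := hf'.primal_pl hw'
  set L := L₁ + L₁ ^ 2 / μ₂ with hL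
  have hL0 : 0 < L := by positivity
  have hL₁L : L₁ ≤ L := by rw [hL]; have : 0 < L₁ ^ 2 / μ₂ := by positivity
                           linarith
  set p := gradX f x w with hpp
  set p' := gradX f' x w' with hpp'
  have h1 := hf.maxY_add_le hw ((1 / (4 * L)) • p')
  have h2 := hf'.le_maxY_add hw' ((1 / (4 * L)) • p')
  -- With `S = ‖p'‖² / (16 * L)`, the new primal function gains at least `4 * S - S / 2`. The old
  -- one gains at most its suboptimality plus `S`, the cross term being split by Young's inequality.
  -- PL for the new game bounds `S` from below.
  refine ⟨x + (1 / (4 * L)) • p', ?_⟩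
  rw [inner_smul_right, norm_smul, Real.norm_of_nonneg (by positivity), ← hL, ← hpp] at h1
  rw [← hpp', inner_smul_right, real_inner_self_eq_norm_sq, norm_smul,
    Real.norm_of_nonneg (by positivity)] at h2
  set S := ‖p'‖ ^ 2 / (16 * L) with hS
  have hS0 : 0 ≤ S := by positivity
  have hin : 1 / (4 * L) * inner ℝ p p' ≤ ‖p‖ ^ 2 / (2 * L) + S / 2 := by
    have h := norm_sub_sq_real p ((1 / 4 : ℝ) • p')
    rw [inner_smul_right, norm_smul, Real.norm_of_nonneg (by positivity)] at h
    have h0 : 0 ≤ ‖p - (1 / 4 : ℝ) • p'‖ ^ 2 / (2 * L) := by positivity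
    rw [h] at h0
    have e : (‖p‖ ^ 2 - 2 * (1 / 4 * inner ℝ p p') + (1 / 4 * ‖p'‖) ^ 2) / (2 * L) =
        ‖p‖ ^ 2 / (2 * L) + S / 2 - 1 / (4 * L) * inner ℝ p p' := by
      rw [hS]
      field_simp
      ring
    linarith
  have hpa : ‖p‖ ^ 2 / (2 * L) ≤ maxY f x - minMax f := by
    rw [div_le_iff₀ (by positivity)]
    linarith
  have e1 : L / 2 * (1 / (4 * L) * ‖p'‖) ^ 2 = S / 2 := by rw [hS]; field_simp; ring
  have e2 : 1 / (4 * L) * ‖p'‖ ^ 2 = 4 * S := by rw [hS]; field_simp; ring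
  have e3 : L₁ / 2 * (1 / (4 * L) * ‖p'‖) ^ 2 ≤ S / 2 := by rw [← e1]; gcongr
  have e4 : μ₁ / (8 * L) * (maxY f' x - minMax f') ≤ S := by
    rw [hS, div_mul_eq_mul_div, div_le_div_iff₀ (by positivity) (by positivity)]
    nlinarith [mul_le_mul_of_nonneg_right hp' hL0.le]
  linarith

/-- The largest increase of the gap function exceeds the increase at a point where the old gap is
small by a fixed fraction of the new gap. -/
theorem exists_gapFn_sub_ge (hf : SmoothPLSaddle f μ₁ μ₂ L₁) (hf' : SmoothPLSaddle f' μ₁ μ₂ L₁)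
    {c : ℝ} (hc₁ : c ≤ μ₁ / (8 * (L₁ + L₁ ^ 2 / μ₂))) (hc₂ : c ≤ μ₂ / (8 * (L₁ + L₁ ^ 2 / μ₁)))
    (z : Euc m × Euc n) :
    ∃ z', (1 + c) * gapFn f' z - 2 * gapFn f z ≤ gapFn f' z' - gapFn f z' := by
  obtain ⟨x', hx'⟩ := hf.exists_maxY_sub_ge hf' z.1
  -- The gap splits into a function of `x` plus a function of `y`, so the two test points are chosen
  -- independently.
  obtain ⟨y', hy'⟩ := hf.swap.exists_maxY_sub_ge hf'.swap z.2
  refine ⟨(x', y'), ?_⟩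
  have h1 := mul_le_mul_of_nonneg_right hc₁ (sub_nonneg.2 (hf'.minMax_le z.1))
  have h2 := mul_le_mul_of_nonneg_right hc₂ (sub_nonneg.2 (hf'.swap.minMax_le z.2))
  rw [hf.gapFn_eq z, hf'.gapFn_eq z, hf.gapFn_eq, hf'.gapFn_eq]
  linarith

/-- Each extremum is compared at the new game's optimizer; keeping the worse of the two points costs
the factor 2. -/
theorem exists_gapFn_sub_le (hf : SmoothPLSaddle f μ₁ μ₂ L₁) (hf' : SmoothPLSaddle f' μ₁ μ₂ L₁)
    (z : Euc m × Euc n) :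
    ∃ p : Euc m × Euc n, gapFn f' z - gapFn f z ≤ 2 * |f' p.1 p.2 - f p.1 p.2| := by
  obtain ⟨w, hw⟩ := hf'.exists_eq_maxY z.1
  obtain ⟨u, hu⟩ := hf'.exists_eq_minX z.2
  have h1 := le_abs_self (f' z.1 w - f z.1 w)
  have h2 := neg_abs_le (f' u z.2 - f u z.2)
  have h3 := hf.le_maxY z.1 w
  have h4 := hf.minX_le u z.2
  have h5 : gapFn f' z - gapFn f z ≤ |f' z.1 w - f z.1 w| + |f' u z.2 - f u z.2| := by
    simp only [gapFn]
    linarith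
  rcases le_total |f' z.1 w - f z.1 w| |f' u z.2 - f u z.2| with h | h
  · exact ⟨(u, z.2), by simp only; linarith⟩
  · exact ⟨(z.1, w), by simp only; linarith⟩

end SmoothPLSaddle

end Potential

/-! ### Summing the recursions over rounds. -/

section Summation

theorem sum_le_two_mul_sub_add_sum_succ {s h e : ℕ → ℝ} (hs : ∀ t, 2 * h t ≤ s t)
    (he : ∀ t, s (t + 1) - h t ≤ e t) (he0 : ∀ t, 0 ≤ e t) {T : ℕ} (hT : 1 ≤ T) :
    ∑ t ∈ Icc 1 T, s t ≤ 2 * (s 1 - h T) + 2 * ∑ t ∈ Icc 1 T, e t := by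
  -- The term `e T` concerns `s (T + 1)`, which is not yet in the sum; the induction closes only
  -- without it.
  have key : ∑ t ∈ Icc 1 T, s t ≤ 2 * (s 1 - h T) + 2 * (∑ t ∈ Icc 1 T, e t - e T) := by
    induction T, hT using Nat.le_induction with
    | base => simp; linarith [hs 1]
    | succ T hT ih =>
      rw [sum_Icc_succ_top (by omega), sum_Icc_succ_top (by omega)]
      linarith [hs (T + 1), he T]
  linarith [he0 T]

theorem sum_le_two_mul_sub_add_sum_pred {s h e : ℕ → ℝ} (hs : ∀ t, 2 * h t ≤ s t)
    (he : ∀ t, s t - h (t - 1) ≤ e t) (he0 : ∀ t, 0 ≤ e t) {T : ℕ} (hT : 1 ≤ T) :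
    ∑ t ∈ Icc 1 T, s t ≤ 2 * (s 1 - h T) + 2 * ∑ t ∈ Icc 1 T, e t := by
  induction T, hT using Nat.le_induction with
  | base => simp; linarith [hs 1, he0 1]
  | succ T hT ih =>
    rw [sum_Icc_succ_top (by omega), sum_Icc_succ_top (by omega)]
    have := he (T + 1)
    rw [Nat.add_sub_cancel] at this
    linarith [hs (T + 1)]

/-- After shifting the index, the surplus `c * ∑ s` covers both `2 * ∑ h` and the boundary term `2 *
h T`, each `h t` being at most `c * s t / 4`. -/
theorem sum_le_sum_add_two_mul_sub {s h : ℕ → ℝ} {c : ℝ} (hc0 : 0 ≤ c) (hc1 : c ≤ 1)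
    (hs0 : ∀ t, 0 ≤ s t) (hs : ∀ t, 4 * h t ≤ c * s t) {T : ℕ} (hT : 1 ≤ T) :
    ∑ t ∈ Icc 1 T, s t ≤ ∑ t ∈ Icc 1 T, ((1 + c) * s (t + 1) - 2 * h t) + 2 * (s 1 - h T) := by
  have h1 : ∑ t ∈ Icc 1 T, s (t + 1) = ∑ t ∈ Icc 1 T, s t - s 1 + s (T + 1) := by
    induction T, hT using Nat.le_induction with
    | base => simp
    | succ T hT ih =>
      rw [sum_Icc_succ_top (by omega), sum_Icc_succ_top (by omega), ih]
      ring
  have h2 : 4 * ∑ t ∈ Icc 1 T, h t ≤ c * ∑ t ∈ Icc 1 T, s t := by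
    rw [mul_sum, mul_sum]
    exact sum_le_sum fun t _ => hs t
  have h3 : s T ≤ ∑ t ∈ Icc 1 T, s t :=
    single_le_sum (fun t _ => hs0 t) (mem_Icc.2 ⟨hT, le_rfl⟩)
  rw [sum_sub_distrib, ← mul_sum, ← mul_sum, h1]
  have h4 := mul_le_mul_of_nonneg_left h3 hc0
  have h5 := mul_nonneg (sub_nonneg.2 hc1) (hs0 1)
  have h6 := mul_nonneg hc0 (hs0 (T + 1))
  linarith [hs T, hs0 (T + 1)]

theorem coe_sum_le_sum {ι : Type*} {S : Finset ι} {r : ι → ℝ} {u : ι → EReal}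
    (h : ∀ i ∈ S, (r i : EReal) ≤ u i) : ((∑ i ∈ S, r i : ℝ) : EReal) ≤ ∑ i ∈ S, u i := by
  induction S using Finset.cons_induction with
  | empty => simp
  | cons i S hi ih =>
    rw [sum_cons, sum_cons, EReal.coe_add]
    exact add_le_add (h i (mem_cons_self i S)) (ih fun j hj => h j (mem_cons_of_mem hj))

theorem coe_le_coe_add_mul_of_le {A B C r : ℝ} {X : EReal} (hC : 0 ≤ C) (h : A ≤ B + C * r)
    (hr : (r : EReal) ≤ X) : (A : EReal) ≤ (B : EReal) + (C : EReal) * X := by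
  refine (EReal.coe_le_coe_iff.2 h).trans ?_
  rw [EReal.coe_add, EReal.coe_mul]
  exact add_le_add le_rfl (mul_le_mul_of_nonneg_left hr (EReal.coe_nonneg.2 hC))

end Summation

end

/-! ### Assembly of the two regret bounds. -/

theorem mainTheorem5 (μ₁ μ₂ L₁ : ℝ) (hμ₁ : 0 < μ₁) (hμ₂ : 0 < μ₂)
    (hμL₁ : μ₁ ≤ L₁) (hμL₂ : μ₂ ≤ L₁) :
    ∃ β₀ C : ℝ, 0 < C ∧
      ∀ (m n : ℕ) (f : ℕ → Euc m → Euc n → ℝ),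
        (∀ t, TwoSidedPL (f t) μ₁ μ₂) →
        (∀ t, BlockSmooth (f t) L₁) →
        (∀ t, SaddleAssumption (f t)) →
      ∀ τ₁ τ₂ ρ β : ℝ,
        τ₁ = μ₂ ^ 2 / (18 * L₁ ^ 3) →
        τ₂ = 1 / L₁ →
        1 - μ₁ * μ₂ ^ 2 / (36 * L₁ ^ 3) ≤ ρ → ρ < 1 →
        agdaBeta μ₁ μ₂ L₁ τ₁ ≤ β →
      ∀ (xs : ℕ → Euc n → Euc m) (ys : ℕ → Euc m → Euc n),
        (∀ t y, IsMinOn (fun x => f t x y) Set.univ (xs t y)) →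
        (∀ t x, IsMaxOn (fun y => f t x y) Set.univ (ys t x)) →
      ∀ (z : ℕ → Euc m × Euc n), (∃ z₀, z = onlineAGDA τ₁ τ₂ ρ β f z₀) →
      ∀ T : ℕ, 1 ≤ T →
        (β₀ ≤ β →
          (dualGap f z T : EReal) ≤
            varU f T + ((2 * (gapFn (f 1) (z 1) - gapFn (f T) (z (T + 1))) : ℝ) : EReal)) ∧
        (dualGap f z T : EReal) ≤
          ((2 * (gapFn (f 1) (z 1) - gapFn (f T) (z (T + 1))) : ℝ) : EReal)
            + (C : EReal) * min (varU f T)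
                (min (varV f T + ((pathLen z T + varC xs ys z T : ℝ) : EReal))
                  (varV f T + ((varC' xs ys z T : ℝ) : EReal))) := by
  have hL₁ : 0 < L₁ := hμ₁.trans_le hμL₁
  set B := agdaBeta μ₁ μ₂ L₁ (μ₂ ^ 2 / (18 * L₁ ^ 3)) with hB
  have hB0 : 0 < B := agdaBeta_pos hμ₁ hμ₂ hL₁ _
  obtain ⟨c, hc⟩ : ∃ c, c = min (μ₁ / (8 * (L₁ + L₁ ^ 2 / μ₂))) (μ₂ / (8 * (L₁ + L₁ ^ 2 / μ₁))) :=
    ⟨_, rfl⟩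
  have hc0 : 0 < c := hc ▸ lt_min (by positivity) (by positivity)
  have hcx : c ≤ μ₁ / (8 * (L₁ + L₁ ^ 2 / μ₂)) := hc ▸ min_le_left _ _
  have hcy : c ≤ μ₂ / (8 * (L₁ + L₁ ^ 2 / μ₁)) := hc ▸ min_le_right _ _
  have hc1 : c ≤ 1 := by
    refine hcx.trans ((div_le_one (by positivity)).2 ?_)
    have : 0 < L₁ ^ 2 / μ₂ := by positivity
    linarith
  -- The threshold `2 * B / c` turns `2 * β * h t ≤ B * s t` into `4 * h t ≤ c * s t`. The constant
  -- 4 is 2 from halving times 2 from the two extrema in the gap.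
  refine ⟨2 * B / c, 4, by norm_num, ?_⟩
  intro m n f hpl hsm hsad τ₁ τ₂ ρ β hτ₁ hτ₂ hρ hρ1 hβ xs ys hxs hys z ⟨z₀, hz⟩ T hT
  subst hτ₁ hτ₂
  have hf : ∀ t, SmoothPLSaddle (f t) μ₁ μ₂ L₁ := fun t =>
    ⟨hμ₁, hμ₂, hμL₁, hμL₂, hpl t, hsm t, hsad t⟩
  have hstep : ∀ t, 2 * β * gapFn (f t) (z (t + 1)) ≤ B * gapFn (f t) (z t) := fun t => by
    rw [hz]
    exact (hf t).gapFn_innerLoop_le hρ hρ1 hβ _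
  obtain ⟨s, hs⟩ : ∃ s : ℕ → ℝ, s = fun t => gapFn (f t) (z t) := ⟨_, rfl⟩
  obtain ⟨h, hh⟩ : ∃ h : ℕ → ℝ, h = fun t => gapFn (f t) (z (t + 1)) := ⟨_, rfl⟩
  have hs0 : ∀ t, 0 ≤ s t := fun t => by rw [hs]; exact (hf t).gapFn_nonneg _
  have hh0 : ∀ t, 0 ≤ h t := fun t => by rw [hh]; exact (hf t).gapFn_nonneg _
  have hsh : ∀ t, 2 * β * h t ≤ B * s t := fun t => by rw [hs, hh]; exact hstep t
  have hhalf : ∀ t, 2 * h t ≤ s t := fun t => by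
    have h1 := mul_le_mul_of_nonneg_right hβ (hh0 t)
    have h2 : B * (2 * h t) ≤ B * s t := by linarith [hsh t]
    exact le_of_mul_le_mul_left h2 hB0
  have hgap : dualGap f z T = ∑ t ∈ Finset.Icc 1 T, s t := by rw [hs]; rfl
  have hbdry : 2 * (gapFn (f 1) (z 1) - gapFn (f T) (z (T + 1))) = 2 * (s 1 - h T) := by
    rw [hs, hh]
  rw [hgap, hbdry]
  refine ⟨fun hβ₀ => ?_, ?_⟩
  · have h4 : ∀ t, 4 * h t ≤ c * s t := fun t => by
      have h1 : 2 * B ≤ β * c := (div_le_iff₀ hc0).1 hβ₀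
      have h2 := mul_le_mul_of_nonneg_right h1 (hh0 t)
      have h3 := mul_le_mul_of_nonneg_left (hsh t) hc0.le
      have h5 : B * (4 * h t) ≤ B * (c * s t) := by linarith
      exact le_of_mul_le_mul_left h5 hB0
    refine (EReal.coe_le_coe_iff.2 (sum_le_sum_add_two_mul_sub hc0.le hc1 hs0 h4 hT)).trans ?_
    rw [EReal.coe_add]
    refine add_le_add (coe_sum_le_sum fun t _ => ?_) le_rfl
    obtain ⟨z', hz'⟩ := (hf t).exists_gapFn_sub_ge (hf (t + 1)) hcx hcy (z (t + 1))
    refine le_iSup_of_le z' (EReal.coe_le_coe_iff.2 ?_)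
    rw [hs, hh]
    exact hz'
  · have hU : ((∑ t ∈ Finset.Icc 1 T, max 0 (s (t + 1) - h t) : ℝ) : EReal) ≤ varU f T := by
      refine coe_sum_le_sum fun t _ => ?_
      rcases max_choice 0 (s (t + 1) - h t) with h1 | h1 <;> rw [h1]
      · obtain ⟨p, hp⟩ := (hf t).exists_gapFn_eq_zero
        refine le_iSup_of_le p (EReal.coe_le_coe_iff.2 ?_)
        rw [hp, sub_zero]
        exact (hf (t + 1)).gapFn_nonneg p
      · rw [hs, hh]
        exact le_iSup (fun z => ((gapFn (f (t + 1)) z - gapFn (f t) z : ℝ) : EReal)) (z (t + 1))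
    have hV : ((∑ t ∈ Finset.Icc 1 T, max 0 (s t - h (t - 1)) / 2 : ℝ) : EReal) ≤ varV f T := by
      refine coe_sum_le_sum fun t ht => ?_
      -- The range starts at 1, so the truncated `t - 1` is a true predecessor; round 0 enters only
      -- through the nonnegative first term.
      have ht1 : t - 1 + 1 = t := Nat.sub_add_cancel (Finset.mem_Icc.1 ht).1
      obtain ⟨p, hp⟩ := (hf (t - 1)).exists_gapFn_sub_le (hf t) (z t)
      refine le_iSup_of_le p (EReal.coe_le_coe_iff.2 ?_)
      rw [div_le_iff₀ two_pos, mul_comm]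
      refine max_le (by positivity) ?_
      rw [hs, hh]
      simpa only [ht1] using hp
    have hSU := sum_le_two_mul_sub_add_sum_succ (e := fun t => max 0 (s (t + 1) - h t)) hhalf
      (fun t => le_max_right _ _) (fun t => le_max_left _ _) hT
    have hSV := sum_le_two_mul_sub_add_sum_pred (e := fun t => max 0 (s t - h (t - 1))) hhalf
      (fun t => le_max_right _ _) (fun t => le_max_left _ _) hT
    have hVadd : ∀ {a : ℝ}, 0 ≤ a → ((∑ t ∈ Finset.Icc 1 T, s t : ℝ) : EReal) ≤
        ((2 * (s 1 - h T) : ℝ) : EReal) + ((4 : ℝ) : EReal) * (varV f T + (a : EReal)) := by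
      intro a ha
      refine coe_le_coe_add_mul_of_le (by norm_num) ?_
        (hV.trans (le_add_of_nonneg_right (EReal.coe_nonneg.2 ha)))
      rw [← Finset.sum_div]
      linarith
    rcases min_choice (varU f T) (min (varV f T + ((pathLen z T + varC xs ys z T : ℝ) : EReal))
      (varV f T + ((varC' xs ys z T : ℝ) : EReal))) with h1 | h1 <;> rw [h1]
    · refine coe_le_coe_add_mul_of_le (by norm_num) ?_ hU
      have : 0 ≤ ∑ t ∈ Finset.Icc 1 T, max 0 (s (t + 1) - h t) :=
        Finset.sum_nonneg fun t _ => le_max_left _ _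
      linarith
    · rcases min_choice (varV f T + ((pathLen z T + varC xs ys z T : ℝ) : EReal))
        (varV f T + ((varC' xs ys z T : ℝ) : EReal)) with h2 | h2 <;> rw [h2]
      · refine hVadd (add_nonneg ?_ ?_)
        · exact Finset.sum_nonneg fun t _ => norm_nonneg _
        · exact Finset.sum_nonneg fun t _ => by positivity
      · exact hVadd (Finset.sum_nonneg fun t _ => by positivity)
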